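/- **Definitions.** Let $\mathcal I$ be a $\sigma$-ideal on a set $X$ (a family of subsets of $X$ that contains $\emptyset$ but not $X$ and is closed under subsets and countable unions). Put $\mathcal I^+=\mathcal P(X)\setminus\mathcal I$, and let $\mathsf{add}(\mathcal I)$ be the least cardinality of a subfamily of $\mathcal I$ whose union is in $\mathcal I^+$. $\mathcal I$ is *supersaturated* if for every $\mathcal A\subseteq\mathcal I^+$ with $|\mathcal A|<\mathsf{add}(\mathcal I)$ there is a countable $W\subseteq X$ such that $A\cap W\neq\emptyset$ for every $A\in\mathcal A$. A *normal ideal* on a cardinal $\kappa$, where $\kappa$ is regular and uncountable, is a proper ideal on $\kappa$ that contains all bounded subsets of $\kappa$ and is closed under diagonal unions: if $A_\xi\in\mathcal I$ for all $\xi<\kappa$, then $\{\alpha<\kappa:(\exists\xi<\alpha)\ \alpha\in A_\xi\}\in\mathcal I$. For an ideal $\mathcal I$ on $\kappa$ in $V$, the ideal generated by $\mathcal I$ in $V^{\mathbb P}$ is $\{x\subseteq\kappa:(\exists Y\in\mathcal I)\ x\subseteq Y\}$. A forcing $\mathbb P$ (a preorder with a largest element) is *$\kappa$-ssp* if for every normal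 supersaturated ideal $\mathcal I$ on $\kappa$, $V^{\mathbb P}\models$ "the ideal generated by $\mathcal I$ is a supersaturated $\sigma$-ideal on $\kappa$". $\mathbb P$ is *$\sigma$-linked* if $\mathbb P=\bigcup_{n<\omega}L_n$, where any two members of each $L_n$ have a common extension in $\mathbb P$. **Theorem.** Every $\sigma$-linked forcing is $\kappa$-ssp for every cardinal $\kappa$. -/

import Mathlib

universe u

open Cardinal

/-! # Ideals in the ground model -/

section Ideals

variable {X : Type u}

/-- `I` is an ideal of subsets of `X`, possibly improper. -/
structure IsIdealOn (I : Set (Set X)) : Prop where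
  empty_mem : ∅ ∈ I
  mem_of_subset : ∀ A B : Set X, B ∈ I → A ⊆ B → A ∈ I
  union_mem : ∀ A B : Set X, A ∈ I → B ∈ I → A ∪ B ∈ I

/-- `I` is a (proper) `σ`-ideal on `X`. -/
structure IsSigmaIdealOn (I : Set (Set X)) : Prop where
  empty_mem : ∅ ∈ I
  mem_of_subset : ∀ A B : Set X, B ∈ I → A ⊆ B → A ∈ I
  sUnion_mem : ∀ F : Set (Set X), F.Countable → F ⊆ I → ⋃₀ F ∈ I
  univ_notMem : Set.univ ∉ I

/-- `|𝒜| < add(I)`, where `add(I)` is the least cardinality of a subfamily `F` of `I`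
whose union is `I`-positive. -/
def CardLTAdd (I 𝒜 : Set (Set X)) : Prop :=
  ∀ F : Set (Set X), F ⊆ I → ⋃₀ F ∉ I → #𝒜 < #F

/-- `I` is a supersaturated (that is, `ω₁`-supersaturated) `σ`-ideal on `X`: every family of
fewer than `add(I)` many `I`-positive sets is met by a single countable set. -/
def IsSupersaturated (I : Set (Set X)) : Prop :=
  IsSigmaIdealOn I ∧
    ∀ 𝒜 : Set (Set X), (∀ A ∈ 𝒜, A ∉ I) → CardLTAdd I 𝒜 →
      ∃ W : Set X, W.Countable ∧ ∀ A ∈ 𝒜, (A ∩ W).Nonempty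

end Ideals

/-- `I` is a normal ideal on the regular uncountable cardinal `κ`: a proper ideal that contains
all bounded subsets of `κ` and is closed under diagonal unions.  The well-ordered type
`κ.ord.ToType` of order type `κ` plays the role of the set of ordinals below `κ`. -/
structure IsNormalIdeal (κ : Cardinal.{u}) (I : Set (Set κ.ord.ToType)) : Prop where
  regular : κ.IsRegular
  uncountable : ℵ₀ < κ
  isIdealOn : IsIdealOn I
  univ_notMem : Set.univ ∉ I
  bounded_mem : ∀ β : κ.ord.ToType, Set.Iio β ∈ I
  diag_mem : ∀ A : κ.ord.ToType → Set κ.ord.ToType, (∀ ξ, A ξ ∈ I) →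
    {α | ∃ ξ < α, α ∈ A ξ} ∈ I

/-! # Forcing notions -/

/-- A forcing notion `P` (smaller conditions are stronger) is `σ`-linked: it is a union of
countably many sets, each of which has pairwise compatible members. -/
def IsSigmaLinked (P : Type u) [Preorder P] : Prop :=
  ∃ L : ℕ → Set P, (⋃ n, L n) = Set.univ ∧
    ∀ n, ∀ p ∈ L n, ∀ q ∈ L n, ∃ r, r ≤ p ∧ r ≤ q

namespace Forcing

/-- The class of `P`-names: a name is a set of pairs (name, condition). -/
inductive PName (P : Type u) : Type (u + 1)
  | mk (ι : Type u) (name : ι → PName P) (cond : ι → P) : PName P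

/-- A sentence of the forcing language, given by the relation `p ⊩ φ`. -/
abbrev Sentence (P : Type u) : Type u := P → Prop

variable {P : Type u} [Preorder P]

/-! ## The forcing relation

`fEq x y p` means `p ⊩ x = y`, `fMem x y p` means `p ⊩ x ∈ y`, and the clauses for connectives
and quantifiers are those of the usual recursive definition of `p ⊩ φ`. -/

/-- `p ⊩ x = y`: for every `(a, s) ∈ x` and every `q ≤ p, s`, the conditions that force
`a = b` and extend `t`, for some `(b, t) ∈ y`, are dense below `q`; and the same with `x` and `y`
interchanged. -/
def fEq : PName P → PName P → Sentence P
  | .mk _ a s, .mk _ b t => fun p =>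
      (∀ i, ∀ q ≤ p, q ≤ s i → ∃ r ≤ q, ∃ j, r ≤ t j ∧ fEq (a i) (b j) r) ∧
      (∀ j, ∀ q ≤ p, q ≤ t j → ∃ r ≤ q, ∃ i, r ≤ s i ∧ fEq (a i) (b j) r)

/-- `p ⊩ x ∈ y`: the conditions that force `x = b` and extend `t`, for some `(b, t) ∈ y`,
are dense below `p`. -/
def fMem (x : PName P) : PName P → Sentence P
  | .mk _ b t => fun p => ∀ q ≤ p, ∃ r ≤ q, ∃ j, r ≤ t j ∧ fEq x (b j) r

/-- `p ⊩ ¬ φ`. -/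
def fNot (φ : Sentence P) : Sentence P := fun p => ∀ q ≤ p, ¬ φ q

/-- `p ⊩ φ ∧ ψ`. -/
def fAnd (φ ψ : Sentence P) : Sentence P := fun p => φ p ∧ ψ p

/-- `p ⊩ φ ∨ ψ`. -/
def fOr (φ ψ : Sentence P) : Sentence P := fun p => ∀ q ≤ p, ∃ r ≤ q, φ r ∨ ψ r

/-- `p ⊩ φ → ψ`. -/
def fImp (φ ψ : Sentence P) : Sentence P := fun p => ∀ q ≤ p, φ q → ψ q

/-- `p ⊩ ∀ x, φ x`, with `x` ranging over all names. -/
def fAll (φ : PName P → Sentence P) : Sentence P := fun p => ∀ x, φ x p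

/-- `p ⊩ ∃ x, φ x`, with `x` ranging over all names. -/
def fEx (φ : PName P → Sentence P) : Sentence P := fun p => ∀ q ≤ p, ∃ r ≤ q, ∃ x, φ x r

infix:50 " =ᶠ " => fEq
infix:50 " ∈ᶠ " => fMem
prefix:max "¬ᶠ " => fNot
infixr:35 " ∧ᶠ " => fAnd
infixr:30 " ∨ᶠ " => fOr
infixr:25 " →ᶠ " => fImp

/-- `φ ↔ ψ`. -/
def fIff (φ ψ : Sentence P) : Sentence P := (φ →ᶠ ψ) ∧ᶠ (ψ →ᶠ φ)

infix:20 " ↔ᶠ " => fIff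

/-- `V^P ⊨ φ`: every condition forces `φ`. -/
def Valid (φ : Sentence P) : Prop := ∀ p, φ p

/-! ## Set-theoretic notions, written in the forcing language -/

/-- `x ⊆ y`. -/
def fSub (x y : PName P) : Sentence P := fAll fun z => z ∈ᶠ x →ᶠ z ∈ᶠ y

infix:50 " ⊆ᶠ " => fSub

/-- `w = {x, y}`. -/
def fIsPair (w x y : PName P) : Sentence P :=
  fAll fun v => v ∈ᶠ w ↔ᶠ (v =ᶠ x ∨ᶠ v =ᶠ y)

/-- `z = ⟨x, y⟩ = {{x}, {x, y}}` (Kuratowski's ordered pair). -/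
def fIsOPair (z x y : PName P) : Sentence P :=
  fAll fun w => w ∈ᶠ z ↔ᶠ (fIsPair w x x ∨ᶠ fIsPair w x y)

/-- `⟨x, y⟩ ∈ f`. -/
def fOPairMem (x y f : PName P) : Sentence P :=
  fEx fun z => fIsOPair z x y ∧ᶠ z ∈ᶠ f

/-- `f` is an injective function from `A` to `B`. -/
def fIsInjection (f A B : PName P) : Sentence P :=
  (fAll fun z => z ∈ᶠ f →ᶠ fEx fun x => fEx fun y => x ∈ᶠ A ∧ᶠ y ∈ᶠ B ∧ᶠ fIsOPair z x y) ∧ᶠ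
  (fAll fun x => x ∈ᶠ A →ᶠ fEx fun y => fOPairMem x y f) ∧ᶠ
  (fAll fun x => fAll fun y => fAll fun y' =>
    fOPairMem x y f →ᶠ fOPairMem x y' f →ᶠ y =ᶠ y') ∧ᶠ
  (fAll fun x => fAll fun x' => fAll fun y =>
    fOPairMem x y f →ᶠ fOPairMem x' y f →ᶠ x =ᶠ x')

/-- `|A| ≤ |B|`. -/
def fCardLE (A B : PName P) : Sentence P := fEx fun f => fIsInjection f A B

/-- `|A| < |B|`. -/
def fCardLT (A B : PName P) : Sentence P := fCardLE A B ∧ᶠ ¬ᶠ (fCardLE B A)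

/-- `u = ⋃ F`. -/
def fIsSUnion (u F : PName P) : Sentence P :=
  fAll fun x => x ∈ᶠ u ↔ᶠ fEx fun A => A ∈ᶠ F ∧ᶠ x ∈ᶠ A

/-- `x ∩ y ≠ ∅`. -/
def fMeets (x y : PName P) : Sentence P := fEx fun z => z ∈ᶠ x ∧ᶠ z ∈ᶠ y

/-! ## Canonical names for ground model objects -/

section Check

variable [OrderTop P]

/-- The canonical name of the von Neumann ordinal that is the order type of the elements below
`a` in a well-ordered type: `ǎ = {(b̌, 1) : b < a}`. -/
def checkOrd {α : Type u} [LinearOrder α] [WellFoundedLT α] (a : α) : PName P :=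
  .mk {b : α // b < a} (fun b => checkOrd b.1) (fun _ => ⊤)
termination_by wellFounded_lt.wrap a
decreasing_by exact b.2

/-- The canonical name of a set of ordinals. -/
def checkSet {α : Type u} [LinearOrder α] [WellFoundedLT α] (A : Set α) : PName P :=
  .mk A (fun a => checkOrd a.1) (fun _ => ⊤)

/-- The canonical name of a family of sets of ordinals. -/
def checkFamily {α : Type u} [LinearOrder α] [WellFoundedLT α] (I : Set (Set α)) : PName P :=
  .mk I (fun A => checkSet A.1) (fun _ => ⊤)

/-- The canonical name of `ω`. Recall that `ω` is absolute. -/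
def checkOmega : PName P := checkSet (Set.univ : Set (ULift.{u} ℕ))

/-- `A` is countable. -/
def fCountable (A : PName P) : Sentence P := fCardLE A checkOmega

/-! ## Supersaturation in the forcing extension

An ideal of the extension is given by a formula `J` of the forcing language which defines it:
`J x` says that `x` belongs to the ideal. -/

/-- `x` belongs to the ideal on `X` generated by `I`, where `I` is an ideal of the ground model:
`x ⊆ X` and `x` is covered by a member of `I` (`I` is closed under finite unions). -/
def fGenIdeal (X I : PName P) (x : PName P) : Sentence P :=
  x ⊆ᶠ X ∧ᶠ fEx fun Y => Y ∈ᶠ I ∧ᶠ x ⊆ᶠ Y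

/-- `J` is a (proper) `σ`-ideal on `X`. -/
def fIsSigmaIdealOn (X : PName P) (J : PName P → Sentence P) : Sentence P :=
  (fAll fun x => J x →ᶠ x ⊆ᶠ X) ∧ᶠ
  (fAll fun x => (fAll fun z => ¬ᶠ (z ∈ᶠ x)) →ᶠ J x) ∧ᶠ
  (fAll fun x => fAll fun y => J y →ᶠ x ⊆ᶠ y →ᶠ J x) ∧ᶠ
  (fAll fun F => fAll fun u =>
    fCountable F →ᶠ (fAll fun x => x ∈ᶠ F →ᶠ J x) →ᶠ fIsSUnion u F →ᶠ J u) ∧ᶠ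
  ¬ᶠ (J X)

/-- `|𝒜| < add(J)`: every `F ⊆ J` whose union is `J`-positive has more than `|𝒜|` elements. -/
def fCardLTAdd (J : PName P → Sentence P) (𝒜 : PName P) : Sentence P :=
  fAll fun F => fAll fun u =>
    (fAll fun x => x ∈ᶠ F →ᶠ J x) →ᶠ fIsSUnion u F →ᶠ ¬ᶠ (J u) →ᶠ fCardLT 𝒜 F

/-- `J` is a supersaturated `σ`-ideal on `X`. -/
def fIsSupersaturated (X : PName P) (J : PName P → Sentence P) : Sentence P :=
  fIsSigmaIdealOn X J ∧ᶠ
  fAll fun 𝒜 =>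
    (fAll fun A => A ∈ᶠ 𝒜 →ᶠ (A ⊆ᶠ X ∧ᶠ ¬ᶠ (J A))) →ᶠ
    fCardLTAdd J 𝒜 →ᶠ
    fEx fun W => W ⊆ᶠ X ∧ᶠ fCountable W ∧ᶠ (fAll fun A => A ∈ᶠ 𝒜 →ᶠ fMeets A W)

end Check

/-- `P` is `κ`-ssp (`κ`-supersaturation preserving): for every normal supersaturated ideal `I`
on `κ`, `V^P ⊨` "the ideal on `κ` generated by `I` is supersaturated". -/
def IsKappaSSP (P : Type u) [Preorder P] [OrderTop P] (κ : Cardinal.{u}) : Prop :=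
  ∀ I : Set (Set κ.ord.ToType), IsNormalIdeal κ I → IsSupersaturated I →
    Valid (P := P) (fIsSupersaturated (checkSet (Set.univ : Set κ.ord.ToType))
      (fGenIdeal (checkSet (Set.univ : Set κ.ord.ToType)) (checkFamily I)))

end Forcing

/-! Linkedness makes the guesses of one piece `L n` mutually consistent. Let `f` be an injection
into the ordinals, and let two conditions in `L n` force that `x`, respectively `x'`, is sent to
`b`. They are compatible, and a common extension that forces `f` to be injective forces `x = x'`. So
what one of them says about the preimage of `b` can be transferred to an extension of the other. One
ground model set for each pair `(b, n)` therefore suffices.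

σ-ideal (`fGenIdeal_of_fIsSUnion`): given an injection of the family into `ω`, pick for each `(n,
m)` one set of `I` that some condition in `L m` forces to cover the member numbered `n`. The
countable union of the picked sets covers the union of the family.

Supersaturation: let `𝒜` be a family of fewer than add many positive sets in the extension. Ordinals
below `κ` lie in the ideal and their union `κ` does not, so `𝒜` injects into `κ`. The range of the
injection is bounded by some `c` below some condition, as otherwise the range itself would
contradict the bound on `|𝒜|` (`exists_bound_of_fCardLTAdd`). For `b ≤ c` and each `n`, collect the
ordinals that some condition in `L n` puts into the preimage of `b`. These are fewer than `κ ≤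
add(I)` sets, so a countable `W` in the ground model meets all the positive ones. Each member of `𝒜`
gives rise to a positive one (`exists_decided_notMem`), and linkedness turns a point of `W` in it
into a point of that member (`fMeets_checkSet`). -/

namespace Forcing

namespace PName

variable {P : Type u}

/-- The index type of a name. -/
def Idx : PName P → Type u
  | mk ι _ _ => ι

/-- The names occurring in a name. -/
def nm : (x : PName P) → x.Idx → PName P
  | mk _ a _ => a

/-- The conditions occurring in a name. -/
def cd : (x : PName P) → x.Idx → P
  | mk _ _ s => s

end PName

open PName

/-! ### Regular sentences and the rules of reasoning inside the extension -/

section Regular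

variable {P : Type u} [Preorder P]

/-- A sentence is regular if it is inherited by stronger conditions and holds at every condition
below which it holds densely. -/
class Reg (φ : Sentence P) : Prop where
  mono : ∀ {p q : P}, q ≤ p → φ p → φ q
  dense : ∀ {p : P}, (∀ q ≤ p, ∃ r ≤ q, φ r) → φ p

theorem fEq_iff {x y : PName P} {p : P} : fEq x y p ↔
    (∀ i, ∀ q ≤ p, q ≤ x.cd i → ∃ r ≤ q, ∃ j, r ≤ y.cd j ∧ fEq (x.nm i) (y.nm j) r) ∧
    (∀ j, ∀ q ≤ p, q ≤ y.cd j → ∃ r ≤ q, ∃ i, r ≤ x.cd i ∧ fEq (x.nm i) (y.nm j) r) := by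
  cases x; cases y; rw [fEq]; rfl

theorem fMem_iff {x y : PName P} {p : P} : fMem x y p ↔
    ∀ q ≤ p, ∃ r ≤ q, ∃ j, r ≤ y.cd j ∧ fEq x (y.nm j) r := by
  cases y; rw [fMem]; rfl

instance (x y : PName P) : Reg (fEq x y) where
  mono h h' := by
    rw [fEq_iff] at h' ⊢
    exact ⟨fun i q hq => h'.1 i q (hq.trans h), fun i q hq => h'.2 i q (hq.trans h)⟩
  dense h := by
    rw [fEq_iff]
    constructor
    · intro i q hq hi
      obtain ⟨r, hr, h1⟩ := h q hq
      obtain ⟨s, hs, h2⟩ := (fEq_iff.1 h1).1 i r le_rfl (hr.trans hi)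
      exact ⟨s, hs.trans hr, h2⟩
    · intro i q hq hi
      obtain ⟨r, hr, h1⟩ := h q hq
      obtain ⟨s, hs, h2⟩ := (fEq_iff.1 h1).2 i r le_rfl (hr.trans hi)
      exact ⟨s, hs.trans hr, h2⟩

instance (x y : PName P) : Reg (fMem x y) where
  mono h h' := by
    rw [fMem_iff] at h' ⊢
    exact fun q hq => h' q (hq.trans h)
  dense h := by
    rw [fMem_iff]
    intro q hq
    obtain ⟨r, hr, h1⟩ := h q hq
    obtain ⟨s, hs, h2⟩ := fMem_iff.1 h1 r le_rfl
    exact ⟨s, hs.trans hr, h2⟩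

instance (φ ψ : Sentence P) : Reg (fOr φ ψ) where
  mono h h' := fun q hq => h' q (hq.trans h)
  dense h := by
    intro q hq
    obtain ⟨r, hr, h1⟩ := h q hq
    obtain ⟨s, hs, h2⟩ := h1 r le_rfl
    exact ⟨s, hs.trans hr, h2⟩

instance (φ : PName P → Sentence P) : Reg (fEx φ) where
  mono h h' := fun q hq => h' q (hq.trans h)
  dense h := by
    intro q hq
    obtain ⟨r, hr, h1⟩ := h q hq
    obtain ⟨s, hs, h2⟩ := h1 r le_rfl
    exact ⟨s, hs.trans hr, h2⟩

instance (φ : Sentence P) [Reg φ] : Reg (fNot φ) where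
  mono h h' := fun q hq => h' q (hq.trans h)
  dense h := by
    intro q hq hφ
    obtain ⟨r, hr, h1⟩ := h q hq
    exact h1 r le_rfl (Reg.mono hr hφ)

instance (φ ψ : Sentence P) [Reg φ] [Reg ψ] : Reg (fAnd φ ψ) where
  mono h h' := ⟨Reg.mono h h'.1, Reg.mono h h'.2⟩
  dense h := ⟨Reg.dense fun q hq => (h q hq).imp fun _ hr => ⟨hr.1, hr.2.1⟩,
    Reg.dense fun q hq => (h q hq).imp fun _ hr => ⟨hr.1, hr.2.2⟩⟩

instance (φ ψ : Sentence P) [Reg φ] [Reg ψ] : Reg (fImp φ ψ) where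
  mono h h' := fun q hq => h' q (hq.trans h)
  dense h := by
    intro q hq hφ
    refine Reg.dense fun r hr => ?_
    obtain ⟨s, hs, h1⟩ := h r (hr.trans hq)
    exact ⟨s, hs, h1 s le_rfl (Reg.mono (hs.trans hr) hφ)⟩

instance (φ : PName P → Sentence P) [∀ x, Reg (φ x)] : Reg (fAll φ) where
  mono h h' := fun x => Reg.mono h (h' x)
  dense h := fun x => Reg.dense fun q hq => (h q hq).imp fun _ hr => ⟨hr.1, hr.2 x⟩

instance (x y : PName P) : Reg (fSub x y) := by unfold fSub; infer_instance

instance (x y f : PName P) : Reg (fOPairMem x y f) := by unfold fOPairMem; infer_instance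

instance (f A B : PName P) : Reg (fIsInjection f A B) := by
  unfold fIsInjection fIsOPair fIsPair fIff; infer_instance

instance (A B : PName P) : Reg (fCardLE A B) := by unfold fCardLE; infer_instance

instance (A B : PName P) : Reg (fCardLT A B) := by unfold fCardLT; infer_instance

instance (u F : PName P) : Reg (fIsSUnion u F) := by unfold fIsSUnion fIff; infer_instance

instance (u F : PName P) : Reg (fMeets u F) := by unfold fMeets; infer_instance

instance (X I x : PName P) : Reg (fGenIdeal X I x) := by unfold fGenIdeal; infer_instance

instance (J : PName P → Sentence P) [∀ x, Reg (J x)] (A : PName P) : Reg (fCardLTAdd J A) := by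
  unfold fCardLTAdd; infer_instance

/-- A condition need not decide which disjunct holds, but densely many extensions do; regularity of
`χ` brings the conclusion back to `p`. The other elimination rules work in the same way. -/
theorem fOr.elim {φ ψ χ : Sentence P} [Reg χ] {p : P} (h : fOr φ ψ p)
    (h1 : ∀ r ≤ p, φ r → χ r) (h2 : ∀ r ≤ p, ψ r → χ r) : χ p :=
  Reg.dense fun q hq => by
    obtain ⟨r, hr, h | h⟩ := h q hq
    exacts [⟨r, hr, h1 r (hr.trans hq) h⟩, ⟨r, hr, h2 r (hr.trans hq) h⟩]

theorem fOr.inl {φ ψ : Sentence P} [Reg φ] {p : P} (h : φ p) : fOr φ ψ p :=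
  fun q hq => ⟨q, le_rfl, Or.inl (Reg.mono hq h)⟩

theorem fOr.inr {φ ψ : Sentence P} [Reg ψ] {p : P} (h : ψ p) : fOr φ ψ p :=
  fun q hq => ⟨q, le_rfl, Or.inr (Reg.mono hq h)⟩

theorem fEx.elim {φ : PName P → Sentence P} {χ : Sentence P} [Reg χ] {p : P} (h : fEx φ p)
    (h1 : ∀ r ≤ p, ∀ x, φ x r → χ r) : χ p :=
  Reg.dense fun q hq => by
    obtain ⟨r, hr, x, hx⟩ := h q hq
    exact ⟨r, hr, h1 r (hr.trans hq) x hx⟩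

theorem fEx.intro {φ : PName P → Sentence P} {p : P} (x : PName P) [Reg (φ x)] (h : φ x p) :
    fEx φ p :=
  fun q hq => ⟨q, le_rfl, x, Reg.mono hq h⟩

theorem fMem.elim {x y : PName P} {χ : Sentence P} [Reg χ] {p : P} (h : fMem x y p)
    (h1 : ∀ r ≤ p, ∀ j, r ≤ y.cd j → fEq x (y.nm j) r → χ r) : χ p :=
  Reg.dense fun q hq => by
    obtain ⟨r, hr, j, hj, hx⟩ := fMem_iff.1 h q hq
    exact ⟨r, hr, h1 r (hr.trans hq) j hj hx⟩

/-! ### Equality and membership -/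

theorem fEq_refl (x : PName P) (p : P) : fEq x x p := by
  induction x generalizing p with
  | mk ι a s ih =>
    rw [fEq]
    exact ⟨fun i q _ hi => ⟨q, le_rfl, i, hi, ih i q⟩, fun i q _ hi => ⟨q, le_rfl, i, hi, ih i q⟩⟩

theorem fEq_symm {x y : PName P} {p : P} (h : fEq x y p) : fEq y x p := by
  induction x generalizing y p with
  | mk ι a s ih =>
    rw [fEq_iff] at h ⊢
    constructor
    · intro j q hq hj
      obtain ⟨r, hr, i, hi, e⟩ := h.2 j q hq hj
      exact ⟨r, hr, i, hi, ih i e⟩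
    · intro j q hq hj
      obtain ⟨r, hr, i, hi, e⟩ := h.1 j q hq hj
      exact ⟨r, hr, i, hi, ih j e⟩

theorem fEq_trans {x y z : PName P} {p : P} (h : fEq x y p) (h' : fEq y z p) : fEq x z p := by
  induction x generalizing y z p with
  | mk ι a s ih =>
    rw [fEq_iff] at h h' ⊢
    constructor
    · intro i q hq hi
      obtain ⟨r, hr, j, hj, e⟩ := h.1 i q hq hi
      obtain ⟨r', hr', k, hk, e'⟩ := h'.1 j r (hr.trans hq) hj
      exact ⟨r', hr'.trans hr, k, hk, ih i (Reg.mono hr' e) e'⟩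
    · intro k q hq hk
      obtain ⟨r, hr, j, hj, e⟩ := h'.2 k q hq hk
      obtain ⟨r', hr', i, hi, e'⟩ := h.2 j r (hr.trans hq) hj
      exact ⟨r', hr'.trans hr, i, hi, ih i e' (Reg.mono hr' e)⟩

theorem fMem_congr_left {x x' y : PName P} {p : P} (e : fEq x x' p) (h : fMem x y p) :
    fMem x' y p := by
  rw [fMem_iff] at h ⊢
  intro q hq
  obtain ⟨r, hr, j, hj, hx⟩ := h q hq
  exact ⟨r, hr, j, hj, fEq_trans (fEq_symm (Reg.mono (hr.trans hq) e)) hx⟩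

theorem fMem_congr_right {x y y' : PName P} {p : P} (e : fEq y y' p) (h : fMem x y p) :
    fMem x y' p :=
  h.elim fun _ hr j hj hx => fMem_iff.2 fun q hq => by
    obtain ⟨s, hs, k, hk, e'⟩ := (fEq_iff.1 e).1 j q (hq.trans hr) (hq.trans hj)
    exact ⟨s, hs, k, hk, fEq_trans (Reg.mono (hs.trans hq) hx) e'⟩

theorem fMem_nm {y : PName P} (j : y.Idx) {p : P} (h : p ≤ y.cd j) : fMem (y.nm j) y p :=
  fMem_iff.2 fun q hq => ⟨q, le_rfl, j, hq.trans h, fEq_refl _ _⟩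

theorem fEq_of_forall_mem {x y : PName P} {p : P}
    (h : ∀ z, ∀ q ≤ p, fMem z x q ↔ fMem z y q) : fEq x y p := by
  rw [fEq_iff]
  constructor
  · intro i q hq hi
    exact fMem_iff.1 ((h _ q hq).1 (fMem_nm i hi)) q le_rfl
  · intro i q hq hi
    obtain ⟨r, hr, j, hj, e⟩ := fMem_iff.1 ((h _ q hq).2 (fMem_nm i hi)) q le_rfl
    exact ⟨r, hr, j, hj, fEq_symm e⟩

theorem fSub_congr_left {x x' y : PName P} {p : P} (e : fEq x x' p) (h : fSub x y p) :
    fSub x' y p :=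
  fun z q hq hz => h z q hq (fMem_congr_right (fEq_symm (Reg.mono hq e)) hz)

theorem fSub_congr_right {x y y' : PName P} {p : P} (e : fEq y y' p) (h : fSub x y p) :
    fSub x y' p :=
  fun z q hq hz => fMem_congr_right (Reg.mono hq e) (h z q hq hz)

end Regular

/-! ### Ordered pairs -/

section Pairs

variable {P : Type u} [Preorder P] [OrderTop P]

/-- The canonical name of the unordered pair. -/
def pairName (x y : PName P) : PName P :=
  .mk (ULift Bool) (fun b => bif b.down then x else y) (fun _ => ⊤)

/-- The canonical name of the ordered pair. -/
def opairName (x y : PName P) : PName P := pairName (pairName x x) (pairName x y)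

theorem fMem_pairName {v x y : PName P} {p : P} :
    fMem v (pairName x y) p ↔ fOr (fEq v x) (fEq v y) p := by
  rw [fMem_iff]
  constructor
  · intro h q hq
    obtain ⟨r, hr, ⟨_ | _⟩, -, e⟩ := h q hq
    exacts [⟨r, hr, Or.inr e⟩, ⟨r, hr, Or.inl e⟩]
  · intro h q hq
    obtain ⟨r, hr, e | e⟩ := h q hq
    exacts [⟨r, hr, ⟨true⟩, le_top, e⟩, ⟨r, hr, ⟨false⟩, le_top, e⟩]

/-- Stated as an equality of sentences, so that Kuratowski's formulas can be rewritten away inside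
any larger formula. -/
theorem fIsPair_eq (w x y : PName P) : fIsPair w x y = fEq w (pairName x y) := by
  funext p
  apply propext
  constructor
  · intro h
    refine fEq_of_forall_mem fun z q hq => ?_
    rw [fMem_pairName]
    exact ⟨(h z).1 q hq, (h z).2 q hq⟩
  · intro h z
    exact ⟨fun q hq hz => fMem_pairName.1 (fMem_congr_right (Reg.mono hq h) hz),
      fun q hq hz => fMem_congr_right (fEq_symm (Reg.mono hq h)) (fMem_pairName.2 hz)⟩

theorem fIsOPair_eq (z x y : PName P) : fIsOPair z x y = fEq z (opairName x y) := by
  rw [opairName, ← fIsPair_eq z]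
  unfold fIsOPair
  simp only [fIsPair_eq _ x]
  rfl

theorem fOPairMem_eq (x y f : PName P) : fOPairMem x y f = fMem (opairName x y) f := by
  funext p
  apply propext
  simp only [fOPairMem, fIsOPair_eq]
  constructor
  · exact fun h => h.elim fun r _ z hz => fMem_congr_left hz.1 hz.2
  · exact fun h => fEx.intro (opairName x y) ⟨fEq_refl _ _, h⟩

theorem pairName_congr {x y x' y' : PName P} {p : P} (hx : fEq x x' p) (hy : fEq y y' p) :
    fEq (pairName x y) (pairName x' y') p := by
  refine fEq_of_forall_mem fun z q hq => ?_
  rw [fMem_pairName, fMem_pairName]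
  have hx := Reg.mono hq hx
  have hy := Reg.mono hq hy
  constructor
  · exact fun h => h.elim (fun r hr e => fOr.inl (fEq_trans e (Reg.mono hr hx)))
      (fun r hr e => fOr.inr (fEq_trans e (Reg.mono hr hy)))
  · exact fun h => h.elim (fun r hr e => fOr.inl (fEq_trans e (fEq_symm (Reg.mono hr hx))))
      (fun r hr e => fOr.inr (fEq_trans e (fEq_symm (Reg.mono hr hy))))

theorem opairName_congr {x y x' y' : PName P} {p : P} (hx : fEq x x' p) (hy : fEq y y' p) :
    fEq (opairName x y) (opairName x' y') p :=
  pairName_congr (pairName_congr hx hx) (pairName_congr hx hy)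

theorem fMem_pairName_left (x y : PName P) (p : P) : fMem x (pairName x y) p :=
  fMem_pairName.2 (fOr.inl (fEq_refl _ _))

theorem fMem_pairName_right (x y : PName P) (p : P) : fMem y (pairName x y) p :=
  fMem_pairName.2 (fOr.inr (fEq_refl _ _))

theorem fEq_of_pairName_self_eq {x a b : PName P} {p : P}
    (h : fEq (pairName x x) (pairName a b) p) : fEq x a p :=
  (fMem_pairName.1 (fMem_congr_right (fEq_symm h) (fMem_pairName_left a b p))).elim
    (fun _ _ e => fEq_symm e) (fun _ _ e => fEq_symm e)

theorem fEq_of_pairName_eq {x y y' : PName P} {p : P}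
    (h : fEq (pairName x y) (pairName x y') p) : fEq y y' p :=
  (fMem_pairName.1 (fMem_congr_right h (fMem_pairName_right x y p))).elim
    (fun r hr e => (fMem_pairName.1 (fMem_congr_right (fEq_symm (Reg.mono hr h))
      (fMem_pairName_right x y' r))).elim
        (fun _ hs e' => fEq_trans (Reg.mono hs e) (fEq_symm e')) (fun _ _ e' => fEq_symm e'))
    (fun _ _ e => e)

/-- The singleton of `x` equals one of the two members of the right-hand pair, and `x'` belongs to
both, so `x = x'`. After replacing `x'` by `x`, cancelling the common first entry twice leaves `y =
y'`. -/
theorem opairName_inj {x y x' y' : PName P} {p : P}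
    (h : fEq (opairName x y) (opairName x' y') p) : fEq x x' p ∧ fEq y y' p := by
  have hx : fEq x x' p :=
    (fMem_pairName.1 (fMem_congr_right h (fMem_pairName_left _ _ p))).elim
      (fun _ _ e => fEq_of_pairName_self_eq e) (fun _ _ e => fEq_of_pairName_self_eq e)
  exact ⟨hx, fEq_of_pairName_eq (fEq_of_pairName_eq
    (fEq_trans h (opairName_congr (fEq_symm hx) (fEq_refl y' p))))⟩

instance (z x y : PName P) : Reg (fIsOPair z x y) := by rw [fIsOPair_eq]; infer_instance

theorem fIsInjection.range_mem {f A B x y : PName P} {p : P} (hf : fIsInjection f A B p)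
    (h : fOPairMem x y f p) : fMem y B p :=
  h.elim fun r hr z hz => (hf.1 z r hr hz.2).elim fun s hs x' h' => h'.elim fun t ht y' h'' => by
    have h1 := Reg.mono (ht.trans hs) hz.1
    simp only [fIsOPair_eq] at h1 h''
    exact fMem_congr_left (fEq_symm (opairName_inj (fEq_trans (fEq_symm h1) h''.2.2)).2) h''.2.1

/-- The name of the relation consisting of the pairs `(a i, b i)` with `s i` in the generic
filter. -/
def relName {ι : Type u} (a b : ι → PName P) (s : ι → P) : PName P :=
  .mk ι (fun i => opairName (a i) (b i)) s

theorem fOPairMem_relName {ι : Type u} {a b : ι → PName P} {s : ι → P} {x y : PName P} {p : P}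
    (h : fOPairMem x y (relName a b s) p) {χ : Sentence P} [Reg χ]
    (h' : ∀ r ≤ p, ∀ i, r ≤ s i → fEq x (a i) r → fEq y (b i) r → χ r) : χ p := by
  rw [fOPairMem_eq] at h
  exact h.elim fun r hr i hi e => h' r hr i hi (opairName_inj e).1 (opairName_inj e).2

/-- Reduces injectivity of a named relation to its generating pairs, each considered only below the
condition attached to it. -/
theorem fIsInjection_relName {ι : Type u} {a b : ι → PName P} {s : ι → P} {A B : PName P} {p : P}
    (hA : ∀ i, ∀ q ≤ p, q ≤ s i → fMem (a i) A q) (hB : ∀ i, ∀ q ≤ p, q ≤ s i → fMem (b i) B q)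
    (hdom : ∀ x, ∀ q ≤ p, fMem x A q → ∃ r ≤ q, ∃ i, r ≤ s i ∧ fEq x (a i) r)
    (hfun : ∀ i j, ∀ q ≤ p, q ≤ s i → q ≤ s j → fEq (a i) (a j) q → fEq (b i) (b j) q)
    (hinj : ∀ i j, ∀ q ≤ p, q ≤ s i → q ≤ s j → fEq (b i) (b j) q → fEq (a i) (a j) q) :
    fIsInjection (relName a b s) A B p := by
  refine ⟨?_, ?_, ?_, ?_⟩
  · intro z q hq hz
    refine hz.elim fun r hr i hi e => fEx.intro (a i) (fEx.intro (b i) ⟨?_, ?_, ?_⟩)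
    · exact hA i r (hr.trans hq) hi
    · exact hB i r (hr.trans hq) hi
    · rw [fIsOPair_eq]
      exact e
  · intro x q hq hx r hr
    obtain ⟨t, ht, i, hi, e⟩ := hdom x r (hr.trans hq) (Reg.mono hr hx)
    refine ⟨t, ht, b i, ?_⟩
    change fOPairMem x (b i) _ t
    rw [fOPairMem_eq]
    exact fMem_congr_left (opairName_congr (fEq_symm e) (fEq_refl _ _))
      (fMem_nm (y := relName a b s) i hi)
  · intro x y y' q hq h r hr h'
    refine fOPairMem_relName (Reg.mono hr h) fun t ht i hi ex ey => ?_
    refine fOPairMem_relName (Reg.mono ht h') fun v hv j hj ex' ey' => ?_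
    exact fEq_trans (Reg.mono hv ey) (fEq_trans (hfun i j v
      (hv.trans (ht.trans (hr.trans hq))) (hv.trans hi) hj
      (fEq_trans (fEq_symm (Reg.mono hv ex)) ex')) (fEq_symm ey'))
  · intro x x' y q hq h r hr h'
    refine fOPairMem_relName (Reg.mono hr h) fun t ht i hi ex ey => ?_
    refine fOPairMem_relName (Reg.mono ht h') fun v hv j hj ex' ey' => ?_
    exact fEq_trans (Reg.mono hv ex) (fEq_trans (hinj i j v
      (hv.trans (ht.trans (hr.trans hq))) (hv.trans hi) hj
      (fEq_trans (fEq_symm (Reg.mono hv ey)) ey')) (fEq_symm ex'))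

end Pairs

/-! ### Canonical names -/

section CheckNames

variable {P : Type u} [Preorder P] [OrderTop P] {α : Type u} [LinearOrder α] [WellFoundedLT α]

theorem checkOrd_eq (a : α) : (checkOrd a : PName P) = checkSet (Set.Iio a) := by
  rw [checkOrd]; rfl

theorem fMem_checkSet_iff {x : PName P} {A : Set α} {p : P} :
    fMem x (checkSet A) p ↔ ∀ q ≤ p, ∃ r ≤ q, ∃ a ∈ A, fEq x (checkOrd a) r := by
  rw [fMem_iff]
  exact ⟨fun h q hq => let ⟨r, hr, j, _, e⟩ := h q hq; ⟨r, hr, j.1, j.2, e⟩,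
    fun h q hq => let ⟨r, hr, a, ha, e⟩ := h q hq; ⟨r, hr, ⟨a, ha⟩, le_top, e⟩⟩

theorem fMem_checkSet_elim {x : PName P} {A : Set α} {p : P} (h : fMem x (checkSet A) p)
    {χ : Sentence P} [Reg χ] (h' : ∀ r ≤ p, ∀ a ∈ A, fEq x (checkOrd a) r → χ r) : χ p :=
  h.elim fun r hr j _ e => h' r hr j.1 j.2 e

theorem fMem_checkSet_of_mem {A : Set α} {a : α} (ha : a ∈ A) (p : P) :
    fMem (checkOrd a) (checkSet A) p :=
  fMem_checkSet_iff.2 fun q _ => ⟨q, le_rfl, a, ha, fEq_refl _ _⟩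

theorem fSub_checkSet {A B : Set α} (h : A ⊆ B) (p : P) : fSub (checkSet A) (checkSet B) p :=
  fun _ _ _ hz => fMem_checkSet_elim hz fun _ _ _ ha e =>
    fMem_congr_left (fEq_symm e) (fMem_checkSet_of_mem (h ha) _)

/-- If the names were forced equal, `b` would be forced into itself, hence some extension would
force it equal to a smaller ordinal; this descent is impossible. -/
theorem not_fEq_checkOrd_of_lt {a b : α} (h : b < a) (p : P) :
    ¬ fEq (checkOrd a) (checkOrd b) p := by
  induction a using WellFoundedLT.induction generalizing b p with
  | _ a ih =>
    intro e
    have h1 : fMem (checkOrd b) (checkOrd a) p := by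
      rw [checkOrd_eq a]
      exact fMem_checkSet_of_mem (Set.mem_Iio.2 h) p
    have h2 := fMem_congr_right e h1
    nth_rw 2 [checkOrd_eq b] at h2
    obtain ⟨r, -, c, hc, e'⟩ := fMem_checkSet_iff.1 h2 p le_rfl
    exact ih b h hc r e'

theorem eq_of_fEq_checkOrd {a b : α} {p : P} (h : fEq (checkOrd a) (checkOrd b) p) : a = b := by
  rcases lt_trichotomy a b with h' | h' | h'
  · exact absurd (fEq_symm h) (not_fEq_checkOrd_of_lt h' p)
  · exact h'
  · exact absurd h (not_fEq_checkOrd_of_lt h' p)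

theorem mem_of_fMem_checkSet {A : Set α} {a : α} {p : P} (h : fMem (checkOrd a) (checkSet A) p) :
    a ∈ A := by
  obtain ⟨r, -, c, hc, e⟩ := fMem_checkSet_iff.1 h p le_rfl
  rwa [eq_of_fEq_checkOrd e]

theorem fMem_checkFamily {I : Set (Set α)} {A : Set α} (hA : A ∈ I) (p : P) :
    fMem (checkSet A) (checkFamily I) p :=
  fMem_nm (y := checkFamily I) (⟨A, hA⟩ : I) le_top

theorem fMem_checkFamily_elim {x : PName P} {I : Set (Set α)} {p : P}
    (h : fMem x (checkFamily I) p) {χ : Sentence P} [Reg χ]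
    (h' : ∀ r ≤ p, ∀ A ∈ I, fEq x (checkSet A) r → χ r) : χ p :=
  h.elim fun r hr j _ e => h' r hr j.1 j.2 e

theorem fCountable_checkSet {A : Set α} (hA : A.Countable) (p : P) :
    fCountable (checkSet A) p := by
  obtain ⟨e, he⟩ := Set.countable_iff_exists_injective.1 hA
  refine fEx.intro (relName (fun i : A => checkOrd i.1)
    (fun i : A => checkOrd (ULift.up.{u} (e i))) (fun _ => ⊤)) (fIsInjection_relName ?_ ?_ ?_ ?_ ?_)
  · exact fun i q _ _ => fMem_checkSet_of_mem i.2 q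
  · exact fun i q _ _ => fMem_checkSet_of_mem (Set.mem_univ _) q
  · intro x q _ hx
    obtain ⟨r, hr, a, ha, h⟩ := fMem_checkSet_iff.1 hx q le_rfl
    exact ⟨r, hr, ⟨a, ha⟩, le_top, h⟩
  · intro i j q _ _ _ h
    rw [Subtype.ext (eq_of_fEq_checkOrd h)]
    exact fEq_refl _ _
  · intro i j q _ _ _ h
    rw [he (ULift.up_injective (eq_of_fEq_checkOrd h))]
    exact fEq_refl _ _

theorem fGenIdeal_of_fSub {I : Set (Set α)} {A : Set α} (hA : A ∈ I) {x : PName P} {p : P}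
    (hx : fSub x (checkSet A) p) :
    fGenIdeal (checkSet (Set.univ : Set α)) (checkFamily I) x p :=
  ⟨fun z q hq hz => fSub_checkSet (Set.subset_univ A) q z q le_rfl (hx z q hq hz),
    fEx.intro (checkSet A) ⟨fMem_checkFamily hA p, hx⟩⟩

theorem fGenIdeal_elim {I : Set (Set α)} {x : PName P} {p : P}
    (h : fGenIdeal (checkSet (Set.univ : Set α)) (checkFamily I) x p) {χ : Sentence P} [Reg χ]
    (h' : ∀ r ≤ p, ∀ A ∈ I, fSub x (checkSet A) r → χ r) : χ p :=
  h.2.elim fun _ hr _ hY => fMem_checkFamily_elim hY.1 fun s hs A hA e =>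
    h' s (hs.trans hr) A hA (fSub_congr_right e (Reg.mono hs hY.2))

end CheckNames

end Forcing

/-! ### Additivity of normal ideals -/

/-- Index `F` injectively by ordinals below `κ`. By regularity the indices are bounded by some `b`.
A point of the union that is at least `b` exceeds the index of the set containing it, so it lies in
the diagonal union; the points below `b` form a bounded set. -/
theorem IsNormalIdeal.sUnion_mem {κ : Cardinal.{u}} {I : Set (Set κ.ord.ToType)}
    (hI : IsNormalIdeal κ I) {F : Set (Set κ.ord.ToType)} (hF : F ⊆ I) (hc : #F < κ) :
    ⋃₀ F ∈ I := by
  classical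
  have : NoMaxOrder κ.ord.ToType := Cardinal.noMaxOrder hI.uncountable.le
  have h0 : #F ≤ #κ.ord.ToType := by rw [mk_ord_toType]; exact hc.le
  obtain ⟨e⟩ := Cardinal.le_def _ _ |>.1 h0
  have hb : ∃ b, ∀ A : F, e A < b := by
    by_contra! hb
    have h1 : κ.ord.cof ≤ #(Set.range e) := by
      rw [← Ordinal.cof_toType]
      exact Order.cof_le fun b => let ⟨A, hA⟩ := hb b; ⟨e A, ⟨A, rfl⟩, hA⟩
    rw [hI.regular.cof_ord] at h1
    exact absurd (h1.trans mk_range_le) hc.not_ge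
  obtain ⟨b, hb⟩ := hb
  obtain ⟨c, hbc⟩ := exists_gt b
  -- `D ξ` is the set with index `ξ`, and is empty when `ξ` is not an index.
  set D : κ.ord.ToType → Set κ.ord.ToType :=
    fun ξ => {α | ∃ A : F, e A = ξ ∧ α ∈ A.1} with hD
  have hDI : ∀ ξ, D ξ ∈ I := by
    intro ξ
    by_cases h : ∃ A : F, e A = ξ
    · obtain ⟨A, rfl⟩ := h
      refine hI.isIdealOn.mem_of_subset _ _ (hF A.2) ?_
      rintro α ⟨A', h, hα⟩
      rwa [e.injective h] at hα
    · refine hI.isIdealOn.mem_of_subset _ _ hI.isIdealOn.empty_mem ?_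
      rintro α ⟨A, hA, -⟩
      exact h ⟨A, hA⟩
  refine hI.isIdealOn.mem_of_subset _ _
    (hI.isIdealOn.union_mem _ _ (hI.bounded_mem b) (hI.diag_mem D hDI)) ?_
  rintro α ⟨A, hA, hα⟩
  rcases lt_or_ge α b with h | h
  · exact Or.inl h
  · exact Or.inr ⟨e ⟨A, hA⟩, (hb _).trans_le h, ⟨A, hA⟩, rfl, hα⟩

theorem IsNormalIdeal.cardLTAdd {κ : Cardinal.{u}} {I : Set (Set κ.ord.ToType)}
    (hI : IsNormalIdeal κ I) {𝒜 : Set (Set κ.ord.ToType)} (h𝒜 : #𝒜 < κ) : CardLTAdd I 𝒜 :=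
  fun F hF hU => h𝒜.trans_le <| by
    by_contra! h
    exact hU (hI.sUnion_mem hF h)

namespace Forcing

open PName

variable {P : Type u} [Preorder P] [OrderTop P]

/-! ### The generated ideal is a proper σ-ideal -/

section SigmaIdeal

variable {α : Type u} [LinearOrder α] [WellFoundedLT α] {I : Set (Set α)}

/-- A `σ`-linked forcing covers a countable union of sets in the generated ideal by a set of the
ideal. -/
theorem fGenIdeal_of_fIsSUnion (hP : IsSigmaLinked P) (hI : IsSigmaIdealOn I) {F u : PName P}
    {p : P} (hF : fCountable F p)
    (hJ : ∀ x, ∀ q ≤ p, fMem x F q →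
      fGenIdeal (checkSet (Set.univ : Set α)) (checkFamily I) x q)
    (hu : fIsSUnion u F p) : fGenIdeal (checkSet (Set.univ : Set α)) (checkFamily I) u p := by
  classical
  obtain ⟨L, hL, hlink⟩ := hP
  refine hF.elim fun r hr g hg => ?_
  -- `D n m Y`: some condition in `L m` forces `Y` to cover the member of `F` numbered `n`. `Y (n,
  -- m)` is one such set, or `∅` if there is none.
  let D : ULift.{u} ℕ → ℕ → Set α → Prop := fun n m Y => Y ∈ I ∧ ∃ s ≤ r, s ∈ L m ∧
    ∃ x, fOPairMem x (checkOrd n) g s ∧ fSub x (checkSet Y) s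
  let Y : ULift.{u} ℕ × ℕ → Set α := fun i => if h : ∃ Y, D i.1 i.2 Y then h.choose else ∅
  have hY : ∀ i, Y i ∈ I := by
    intro i
    by_cases h : ∃ Y, D i.1 i.2 Y
    · simp only [Y, dif_pos h]
      exact h.choose_spec.1
    · simp only [Y, dif_neg h]
      exact hI.empty_mem
  have hZ : ⋃₀ Set.range Y ∈ I :=
    hI.sUnion_mem _ (Set.countable_range Y) (Set.range_subset_iff.2 hY)
  refine fGenIdeal_of_fSub hZ fun z q hq hz => ?_
  refine ((hu z).1 q (hq.trans hr) hz).elim fun q₁ hq₁ x hx => ?_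
  refine (hg.2.1 x q₁ (hq₁.trans hq) hx.1).elim fun q₂ hq₂ y hy => ?_
  refine fMem_checkSet_elim ((Reg.mono ((hq₂.trans hq₁).trans hq) hg).range_mem hy)
    fun q₃ hq₃ n _ hn => ?_
  refine fGenIdeal_elim (hJ x q₃ ((((hq₃.trans hq₂).trans hq₁).trans hq).trans hr)
    (Reg.mono (hq₃.trans hq₂) hx.1)) fun q₄ hq₄ B hB hxB => ?_
  have h₂ : q₄ ≤ q₂ := hq₄.trans hq₃
  have hr₄ : q₄ ≤ r := (h₂.trans hq₂).trans (hq₁.trans hq)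
  have hxn : fOPairMem x (checkOrd n) g q₄ := by
    have := Reg.mono h₂ hy
    rw [fOPairMem_eq] at this ⊢
    exact fMem_congr_left (opairName_congr (fEq_refl _ _) (Reg.mono hq₄ hn)) this
  refine Reg.dense fun t ht => ?_
  obtain ⟨m, hm⟩ := Set.mem_iUnion.1 (hL.symm ▸ Set.mem_univ t)
  have hD : ∃ Y, D n m Y :=
    ⟨B, hB, t, ht.trans hr₄, hm, x, Reg.mono ht hxn, Reg.mono ht hxB⟩
  have hYe : Y (n, m) = hD.choose := dif_pos hD
  obtain ⟨-, s, -, hsm, x', hx'n, hx'Y⟩ := hD.choose_spec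
  rw [← hYe] at hx'Y
  -- The condition `s` behind the choice of `Y (n, m)` may concern another name `x'`; below `v` the
  -- injection `g` sends both names to `n`, so they coincide.
  obtain ⟨v, hvt, hvs⟩ := hlink m t hm s hsm
  refine ⟨v, hvt, ?_⟩
  have hxx' : fEq x x' v := hg.2.2.2 x x' (checkOrd n) v (hvt.trans (ht.trans hr₄))
    (Reg.mono (hvt.trans ht) hxn) v le_rfl (Reg.mono hvs hx'n)
  have hzx : fMem z x v := Reg.mono (hvt.trans (ht.trans (h₂.trans hq₂))) hx.2
  exact fSub_checkSet (Set.subset_sUnion_of_mem (Set.mem_range_self (n, m))) v z v le_rfl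
    (hx'Y z v hvs (fMem_congr_right hxx' hzx))

/-- Some condition identifies the covering set with a ground model `A ∈ I`. Membership of ordinals
in canonical names is absolute, so `A` would be everything. -/
theorem not_fGenIdeal_univ (hI : IsSigmaIdealOn I) (p : P) :
    ¬ fGenIdeal (checkSet (Set.univ : Set α)) (checkFamily I)
      (checkSet (Set.univ : Set α)) p := by
  intro h
  obtain ⟨r, -, Y, hY, hs⟩ := h.2 p le_rfl
  obtain ⟨q, hq, A, -, e⟩ := fMem_iff.1 hY r le_rfl
  refine hI.univ_notMem ?_
  convert A.2
  refine (Set.eq_univ_of_forall fun a => mem_of_fMem_checkSet (p := q) ?_).symm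
  exact fMem_congr_right e (hs _ q hq (fMem_checkSet_of_mem (Set.mem_univ a) q))

theorem fIsSigmaIdealOn_fGenIdeal (hP : IsSigmaLinked P) (hI : IsSigmaIdealOn I) (p : P) :
    fIsSigmaIdealOn (checkSet (Set.univ : Set α))
      (fGenIdeal (checkSet (Set.univ : Set α)) (checkFamily I)) p := by
  refine ⟨fun x q _ h => h.1, ?_, ?_, ?_, fun q _ => not_fGenIdeal_univ hI q⟩
  · intro x q _ h
    exact fGenIdeal_of_fSub hI.empty_mem fun z r hr hz => absurd hz (h z r hr)
  · intro x y q _ hy r hr hxy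
    exact fGenIdeal_elim (Reg.mono hr hy) fun s hs A hA h => fGenIdeal_of_fSub hA
      fun z t ht hz => h z t ht (hxy z t (ht.trans hs) hz)
  · intro F u q _ hF r hr hJ s hs hu
    exact fGenIdeal_of_fIsSUnion hP hI (Reg.mono (φ := fCardLE F checkOmega) (hs.trans hr) hF)
      (fun x t ht => hJ x t (ht.trans hs)) hu

end SigmaIdeal

/-! ### Bounding the enumeration and meeting the positive sets -/

section Supersaturation

variable {α : Type u} [LinearOrder α] [WellFoundedLT α] {I : Set (Set α)}

/-- The union of an unbounded set of ordinals. -/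
theorem fIsSUnion_checkSet_univ [NoMaxOrder α] {R : PName P} {p : P}
    (hR : fSub R (checkSet (Set.univ : Set α)) p)
    (h : ∀ a : α, ∀ q ≤ p, ∃ r ≤ q, ∃ b > a, fMem (checkOrd b) R r) :
    fIsSUnion (checkSet (Set.univ : Set α)) R p := by
  intro z
  constructor
  · intro q hq hz
    refine fMem_checkSet_elim hz fun r hr a _ e t ht => ?_
    obtain ⟨v, hv, b, hb, hbR⟩ := h a t (ht.trans (hr.trans hq))
    refine ⟨v, hv, checkOrd b, hbR, ?_⟩
    rw [checkOrd_eq b]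
    exact fMem_congr_left (fEq_symm (Reg.mono (hv.trans ht) e)) (fMem_checkSet_of_mem (Set.mem_Iio.2 hb) v)
  · intro q hq hz
    refine hz.elim fun r hr A hA => ?_
    refine fMem_checkSet_elim (hR A r (hr.trans hq) hA.1) fun s hs a _ e => ?_
    have := fMem_congr_right e (Reg.mono hs hA.2)
    rw [checkOrd_eq] at this
    exact fSub_checkSet (Set.subset_univ _) s z s le_rfl this

/-- A set of ordinals that injects into a family of fewer than `add` many sets is bounded. -/
theorem exists_bound_of_fCardLTAdd [NoMaxOrder α] (hI : IsSigmaIdealOn I)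
    (hb : ∀ a : α, Set.Iio a ∈ I) {𝒜 f : PName P} {p : P}
    (h𝒜 : fCardLTAdd (fGenIdeal (checkSet (Set.univ : Set α)) (checkFamily I)) 𝒜 p)
    (hf : fIsInjection f 𝒜 (checkSet (Set.univ : Set α)) p) :
    ∃ r ≤ p, ∃ a : α, ∀ b > a, ∀ q ≤ r, ∀ x, fMem x 𝒜 q → ¬ fOPairMem x (checkOrd b) f q := by
  by_contra! hcon
  -- `R` names the range of `f`, and `relName a b s` over the same index set names the inverse of
  -- `f`.
  let ι : Type u := {t : α × 𝒜.Idx × P //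
    t.2.2 ≤ 𝒜.cd t.2.1 ∧ fOPairMem (𝒜.nm t.2.1) (checkOrd t.1) f t.2.2}
  let a : ι → PName P := fun i => checkOrd i.1.1
  let b : ι → PName P := fun i => 𝒜.nm i.1.2.1
  let s : ι → P := fun i => i.1.2.2
  let R : PName P := .mk ι a s
  have hRsub : ∀ q, fSub R (checkSet (Set.univ : Set α)) q := fun q z r _ hz =>
    hz.elim fun t _ i _ e => fMem_congr_left (fEq_symm e) (fMem_checkSet_of_mem (Set.mem_univ _) t)
  have hunb : fIsSUnion (checkSet (Set.univ : Set α)) R p := by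
    refine fIsSUnion_checkSet_univ (hRsub p) fun c q hq => ?_
    obtain ⟨d, hd, q', hq', x, hx, hxd⟩ := hcon q hq c
    obtain ⟨v, hv, k, hk, e⟩ := fMem_iff.1 hx q' le_rfl
    have hkd : fOPairMem (𝒜.nm k) (checkOrd d) f v := by
      have := Reg.mono hv hxd
      rw [fOPairMem_eq] at this ⊢
      exact fMem_congr_left (opairName_congr e (fEq_refl _ _)) this
    exact ⟨v, hv.trans hq', d, hd, fMem_nm (y := R) ⟨(d, k, v), hk, hkd⟩ le_rfl⟩
  -- The members of `R` are ordinals, hence in the ideal, but their union is the whole space. So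
  -- `|𝒜| < |R|`, which the inverse of `f` refutes.
  have hlt := h𝒜 R (checkSet Set.univ) p le_rfl
    (fun x q _ hx => fMem_checkSet_elim (hRsub q x q le_rfl hx) fun r _ c _ e =>
      fGenIdeal_of_fSub (hb c) (by
        rw [checkOrd_eq] at e
        exact fSub_congr_left (fEq_symm e) fun _ _ _ h => h))
    p le_rfl hunb p le_rfl (fun q _ => not_fGenIdeal_univ hI q)
  refine hlt.2 p le_rfl (fEx.intro (relName a b s) (fIsInjection_relName ?_ ?_ ?_ ?_ ?_))
  · exact fun i q _ hi => fMem_nm (y := R) i hi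
  · exact fun i q _ hi => fMem_nm (y := 𝒜) i.1.2.1 (hi.trans i.2.1)
  · exact fun x q _ hx => fMem_iff.1 hx q le_rfl
  · intro i j q hq hi hj e
    have h1 := Reg.mono hi i.2.2
    have h2 := Reg.mono hj j.2.2
    rw [← eq_of_fEq_checkOrd e] at h2
    exact hf.2.2.2 _ _ _ q hq h1 q le_rfl h2
  · intro i j q hq hi hj e
    have h1 := Reg.mono hi i.2.2
    have h2 := Reg.mono hj j.2.2
    rw [fOPairMem_eq] at h1
    have h1 := fMem_congr_left (opairName_congr e (fEq_refl _ _)) h1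
    rw [← fOPairMem_eq] at h1
    exact hf.2.2.1 _ _ _ q hq h1 q le_rfl h2

/-- A set which is forced to be positive has, for some linked piece `L n`, positively many
elements that are decided by conditions in `L n`. -/
theorem exists_decided_notMem {L : ℕ → Set P} (hL : ⋃ n, L n = Set.univ) (hI : IsSigmaIdealOn I)
    {A : PName P} {p : P} (hA : fSub A (checkSet (Set.univ : Set α)) p)
    (hpos : ¬ fGenIdeal (checkSet (Set.univ : Set α)) (checkFamily I) A p) :
    ∃ n, {a | ∃ q ≤ p, q ∈ L n ∧ fMem (checkOrd a) A q} ∉ I := by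
  -- Otherwise the countable union of these sets is in `I`, and it covers `A`, since every condition
  -- lies in some `L n`.
  by_contra! h
  refine hpos (fGenIdeal_of_fSub (hI.sUnion_mem _ (Set.countable_range _)
    (Set.range_subset_iff.2 h)) fun z q hq hz => ?_)
  refine fMem_checkSet_elim (hA z q hq hz) fun r hr a _ e => ?_
  refine fMem_congr_left (fEq_symm e) (fMem_checkSet_of_mem ?_ r)
  obtain ⟨n, hn⟩ := Set.mem_iUnion.1 (hL.symm ▸ Set.mem_univ r)
  exact ⟨_, ⟨n, rfl⟩, r, hr.trans hq, hn, fMem_congr_left e (Reg.mono hr hz)⟩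

/-- Suppose that `f` enumerates `𝒜` by ordinals that are at most `c`. A set `W` of the ground
model which meets the positive sets of ordinals decided by the linked pieces meets all members of
`𝒜`. -/
theorem fMeets_checkSet {L : ℕ → Set P} (hL : ⋃ n, L n = Set.univ)
    (hlink : ∀ n, ∀ p ∈ L n, ∀ q ∈ L n, ∃ r, r ≤ p ∧ r ≤ q) (hI : IsSigmaIdealOn I)
    {𝒜 f : PName P} {p : P} {c : α}
    (hpos : ∀ A, ∀ q ≤ p, fMem A 𝒜 q → fSub A (checkSet (Set.univ : Set α)) q ∧
      ¬ fGenIdeal (checkSet (Set.univ : Set α)) (checkFamily I) A q)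
    (hf : fIsInjection f 𝒜 (checkSet (Set.univ : Set α)) p)
    (hc : ∀ b > c, ∀ q ≤ p, ∀ x, fMem x 𝒜 q → ¬ fOPairMem x (checkOrd b) f q)
    {W : Set α}
    (hW : ∀ b ≤ c, ∀ n, {a | ∃ q ∈ L n, ∃ x, fOPairMem x (checkOrd b) f q ∧
      fMem (checkOrd a) x q} ∉ I →
      ({a | ∃ q ∈ L n, ∃ x, fOPairMem x (checkOrd b) f q ∧ fMem (checkOrd a) x q} ∩ W).Nonempty)
    {A : PName P} (hA : fMem A 𝒜 p) : fMeets A (checkSet W) p := by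
  refine (hf.2.1 A p le_rfl hA).elim fun q hq y hy => ?_
  refine fMem_checkSet_elim ((Reg.mono hq hf).range_mem hy) fun r hr b _ e => ?_
  have hrp := hr.trans hq
  have hAb : fOPairMem A (checkOrd b) f r := by
    have := Reg.mono hr hy
    rw [fOPairMem_eq] at this ⊢
    exact fMem_congr_left (opairName_congr (fEq_refl _ _) e) this
  have hbc : b ≤ c := not_lt.1 fun h => hc b h r hrp A (Reg.mono hrp hA) hAb
  refine Reg.dense fun t ht => ?_
  have htp := ht.trans hrp
  obtain ⟨h1, h2⟩ := hpos A t htp (Reg.mono htp hA)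
  obtain ⟨n, hn⟩ := exists_decided_notMem hL hI h1 h2
  -- If `L n` had no condition below `t`, the positive set in `hn` would be empty.
  obtain ⟨v, hv, hvn⟩ : ∃ v ≤ t, v ∈ L n := by
    by_contra! h
    refine hn (hI.mem_of_subset _ _ hI.empty_mem ?_)
    rintro a ⟨v, hv, hvn, -⟩
    exact h v hv hvn
  obtain ⟨a, ⟨w, hwn, x, hxb, hax⟩, haW⟩ := hW b hbc n fun h => hn <| by
    refine hI.mem_of_subset _ _ h ?_
    rintro a ⟨v, hv, hvn, ha⟩
    exact ⟨v, hvn, A, Reg.mono (hv.trans ht) hAb, ha⟩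
  -- The witness `w` need not be below `t`, but it is compatible with `v ≤ t`; at `s` injectivity of
  -- `f` identifies `x` with `A`.
  obtain ⟨s, hsv, hsw⟩ := hlink n v hvn w hwn
  have hst := hsv.trans hv
  refine ⟨s, hst, fEx.intro (checkOrd a) ⟨?_, fMem_checkSet_of_mem haW s⟩⟩
  exact fMem_congr_right (hf.2.2.2 x A (checkOrd b) s (hst.trans htp) (Reg.mono hsw hxb) s le_rfl
    (Reg.mono (hst.trans ht) hAb)) (Reg.mono hsw hax)

end Supersaturation

end Forcing

/-- Every `σ`-linked forcing is `κ`-ssp for every cardinal `κ`. -/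
theorem theorem2p7 (P : Type u) [Preorder P] [OrderTop P] (hP : IsSigmaLinked P)
    (κ : Cardinal.{u}) : Forcing.IsKappaSSP P κ := by
  intro I hN hS p
  have : NoMaxOrder κ.ord.ToType := Cardinal.noMaxOrder hN.uncountable.le
  refine ⟨Forcing.fIsSigmaIdealOn_fGenIdeal hP hS.1 p, fun 𝒜 p₀ _ hpos p₁ hp₁ hadd => ?_⟩
  -- The set `κ` is used as a family of its own initial segments, with union `κ`. This yields `|𝒜| <
  -- κ`, hence the injection `f`.
  have hlt := hadd (Forcing.checkSet Set.univ) (Forcing.checkSet Set.univ) p₁ le_rfl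
    (fun x q _ hx => Forcing.fMem_checkSet_elim hx fun r _ c _ e =>
      Forcing.fGenIdeal_of_fSub (hN.bounded_mem c) (by
        rw [Forcing.checkOrd_eq] at e
        exact Forcing.fSub_congr_left (Forcing.fEq_symm e) fun _ _ _ h => h))
    p₁ le_rfl (Forcing.fIsSUnion_checkSet_univ (fun _ _ _ h => h) fun a q _ =>
      (exists_gt a).elim fun b hb =>
        ⟨q, le_rfl, b, hb, Forcing.fMem_checkSet_of_mem (Set.mem_univ b) q⟩)
    p₁ le_rfl (fun q _ => Forcing.not_fGenIdeal_univ hS.1 q)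
  refine hlt.1.elim fun p₂ hp₂ f hf q hq => ?_
  obtain ⟨r, hr, c, hc⟩ := Forcing.exists_bound_of_fCardLTAdd hS.1 hN.bounded_mem
    (Forcing.Reg.mono (hq.trans hp₂) hadd) (Forcing.Reg.mono hq hf)
  obtain ⟨L, hL, hlink⟩ := hP
  let B : Set.Iic c × ULift.{u} ℕ → Set κ.ord.ToType := fun i =>
    {a | ∃ q ∈ L i.2.down, ∃ x, Forcing.fOPairMem x (Forcing.checkOrd i.1.1) f q ∧
      Forcing.fMem (Forcing.checkOrd a) x q}
  -- The bound `c` matters here: there are at most `|c + 1| · ℵ₀ < κ` sets `B i`.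
  have hcard : #(Set.range B) < κ := by
    refine mk_range_le.trans_lt ?_
    rw [mk_prod, lift_id, lift_id, mk_uLift, mk_nat, lift_aleph0]
    refine mul_lt_of_lt hN.uncountable.le ?_ hN.uncountable
    obtain ⟨d, hd⟩ := exists_gt c
    refine (mk_le_mk_of_subset (Set.Iic_subset_Iio.2 hd)).trans_lt ((mk_Iio_lt d ?_).trans_eq ?_) <;> simp
  obtain ⟨W, hWc, hW⟩ := hS.2 {A | A ∈ Set.range B ∧ A ∉ I} (fun A hA => hA.2)
    (hN.cardLTAdd ((mk_le_mk_of_subset fun A hA => hA.1).trans_lt hcard))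
  refine ⟨r, hr, Forcing.checkSet W, Forcing.fSub_checkSet (Set.subset_univ W) r,
    Forcing.fCountable_checkSet hWc r, fun A s hs hA => ?_⟩
  have hsp : s ≤ p₂ := hs.trans (hr.trans hq)
  exact Forcing.fMeets_checkSet hL hlink hS.1
    (fun A t ht hA => by
      have := hpos A t (ht.trans (hsp.trans (hp₂.trans hp₁))) hA
      exact ⟨this.1, this.2 t le_rfl⟩)
    (Forcing.Reg.mono hsp hf)
    (fun b hb t ht => hc b hb t (ht.trans hs))
    (fun b hb n hn => hW _ ⟨⟨(⟨b, hb⟩, ⟨n⟩), rfl⟩, hn⟩) hA
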